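/- An \emph{$m$-box} in $\mathbb{R}^d$ is a product $\prod_{i=1}^d [a_i,b_i]$ of compact intervals with $a_i\le b_i$, exactly $m$ of which are non-degenerate ($a_i<b_i$). A family of sets in $\mathbb{R}^d$ is \emph{$2$-pierceable} if there is a set of $2$ points such that each member of the family contains at least one of them. For integers $1\le m\le d$ put \[ h=h(d,m,2)=\begin{cases}5 & m=1,\\ 7 & m=2,\\ 3m & m\neq 1 \text{ odd},\\ 3m-1 & m\neq 2\text{ even}.\end{cases} \] Theorem. Let $1\le m\le d$. (i) Let $\mathcal F$ be any (finite or infinite) family of $m$-boxes in $\mathbb{R}^d$ with at least $h$ members. Then $\mathcal F$ is $2$-pierceable if and only if every subfamily of $\mathcal F$ of cardinality $h$ is $2$-pierceable. (ii) If $m<d$ or $m\ge 3$, then $h$ is the smallest integer $k\ge 0$ with the following property: every finite family of $m$-boxes in $\mathbb{R}^d$ with at least $k$ members is $2$-pierceable if and only if every one of its subfamilies of cardinality $k$ is $2$-pierceable. -/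

import Mathlib

/-- `IsBox m B`: the set `B ⊆ ℝ^d` is an `m`-box, i.e. a (closed) axis-parallel rectangular
parallelotope of dimension `m`: a product of `d` compact intervals `[a i, b i]`, exactly `m` of
which are non-degenerate (and the remaining `d - m` are single points). -/
def IsBox {d : ℕ} (m : ℕ) (B : Set (Fin d → ℝ)) : Prop :=
  ∃ a b : Fin d → ℝ, (∀ i, a i ≤ b i) ∧
    (Finset.univ.filter fun i => a i < b i).card = m ∧ B = Set.Icc a b

/-- `IsPierceable n F`: there is a set of `n` points such that every member of the family `F`
contains at least one of them. -/
def IsPierceable {d : ℕ} (n : ℕ) (F : Set (Set (Fin d → ℝ))) : Prop :=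
  ∃ P : Finset (Fin d → ℝ), P.card = n ∧ ∀ B ∈ F, ∃ p ∈ P, p ∈ B

/-- `PiercingProperty d m n k`: every finite family of `m`-boxes in `ℝ^d` (with at least `k`
members) is `n`-pierceable if and only if every subfamily of cardinality `k` is `n`-pierceable. -/
def PiercingProperty (d m n k : ℕ) : Prop :=
  ∀ F : Set (Set (Fin d → ℝ)), F.Finite → (∀ B ∈ F, IsBox m B) → (k : ℕ∞) ≤ F.encard →
    (IsPierceable n F ↔ ∀ G ⊆ F, G.encard = k → IsPierceable n G)

/-- The number `h(d, m, 2)`: `5` for `m = 1`, `7` for `m = 2`, and for `m ≥ 3` it is `3m` if `m` is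
odd and `3m - 1` if `m` is even. -/
def flatBoxNumber (m : ℕ) : ℕ :=
  if m = 1 then 5 else if m = 2 then 7 else if Odd m then 3 * m else 3 * m - 1

/-! In each coordinate `c` let `lo c` be the least right end and `hi c` the greatest left end of the
boxes of a finite family. One may look for piercing points `p`, `q` whose coordinates are `lo c` or
`hi c`, with opposite choices. A box missing both values in one coordinate is disjoint from both
extremal boxes there, and these three boxes already obstruct. Otherwise each box prescribes signs in
some coordinates, up to a global flip (`p` or `q`), and piercing becomes a parity problem, solvable
unless there is an odd cycle of coordinates.

A shortest odd cycle has no chords (`exists_odd_cycle`). Its `k` boxes, with further boxes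
separating `p` from `q` in each of its coordinates, cannot be pierced
(`not_twoPierced_of_odd_cycle`). A coordinate costs one extra box if its two cycle boxes have equal
signs, and otherwise two, or none if one of them is degenerate there. An odd number of coordinates
have unequal signs, and absence of chords leaves each cycle box at most two degenerate cycle
coordinates, so `k ≤ m + 2`; `cycle_count_le_flatBoxNumber` optimizes. Compactness handles infinite
families, and critical families built on such cycles give sharpness. -/

/-! ### The parity obstruction -/

/-- `s` is pierced by two points, where the member `i` of the family is the box `[a i, b i]`. -/
def TwoPierced {ι κ : Type*} (a b : ι → κ → ℝ) (s : Set ι) : Prop :=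
  ∃ p q : κ → ℝ, ∀ i ∈ s, p ∈ Set.Icc (a i) (b i) ∨ q ∈ Set.Icc (a i) (b i)

/-- A truth value as an element of `ZMod 2`. -/
def boolBit (x : Bool) : ZMod 2 := if x then 1 else 0

theorem boolBit_add (x y : Bool) : boolBit x + boolBit y = if x ≠ y then 1 else 0 := by
  cases x <;> cases y <;> decide

/-- An odd cycle of boxes, together with boxes separating the two points in each coordinate of the
cycle, cannot be pierced by two points. -/
theorem not_twoPierced_of_odd_cycle {ι κ : Type*} {a b : ι → κ → ℝ} {G : Set ι} {k : ℕ} [NeZero k]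
    (c : Fin k → κ) (B : Fin k → ι) (s t : Fin k → Bool) (lo hi : Fin k → ℝ)
    (hlh : ∀ j, lo j < hi j) (hB : ∀ j, B j ∈ G)
    (hlo : ∀ j, ∃ i ∈ G, b i (c j) ≤ lo j) (hhi : ∀ j, ∃ i ∈ G, hi j ≤ a i (c j))
    (hs0 : ∀ j, s j = false → b (B j) (c j) < hi j)
    (hs1 : ∀ j, s j = true → lo j < a (B j) (c j))
    (ht0 : ∀ j, t j = false → b (B j) (c (j + 1)) < hi (j + 1))
    (ht1 : ∀ j, t j = true → lo (j + 1) < a (B j) (c (j + 1)))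
    (hodd : ∑ j, (boolBit (s j) + boolBit (t j)) = 1) : ¬ TwoPierced a b G := by
  rintro ⟨p, q, hpq⟩
  -- The lower and the upper box in coordinate `c j` are disjoint, so one contains `p` and the other
  -- `q`.
  have key : ∀ j, (p (c j) ≤ lo j ∧ hi j ≤ q (c j)) ∨ (hi j ≤ p (c j) ∧ q (c j) ≤ lo j) := by
    intro j
    obtain ⟨i, hi1, hi2⟩ := hlo j
    obtain ⟨i', hi1', hi2'⟩ := hhi j
    have h1 := hlh j
    rcases hpq i hi1 with h | h <;> rcases hpq i' hi1' with h' | h'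
    · linarith [h.2 (c j), h'.1 (c j)]
    · exact Or.inl ⟨(h.2 (c j)).trans hi2, hi2'.trans (h'.1 (c j))⟩
    · exact Or.inr ⟨hi2'.trans (h'.1 (c j)), (h.2 (c j)).trans hi2⟩
    · linarith [h.2 (c j), h'.1 (c j)]
  let x : Fin k → Bool := fun j => decide (hi j ≤ p (c j))
  have hx : ∀ j, x j = true ↔ hi j ≤ p (c j) := fun j => by simp [x]
  have hval : ∀ j i y, (y = false → b i (c j) < hi j) → (y = true → lo j < a i (c j)) →
      (p ∈ Set.Icc (a i) (b i) → y = x j) ∧ (q ∈ Set.Icc (a i) (b i) → y = !x j) := by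
    intro j i y h0 h1
    have hl := hlh j
    have hxj := hx j
    refine ⟨fun h => ?_, fun h => ?_⟩ <;> have ha := h.1 (c j) <;> have hb := h.2 (c j) <;>
      cases y <;> cases hxv : x j <;> simp only [hxv] at hxj ⊢ <;> simp at h0 h1 hxj ⊢ <;>
      rcases key j with hk | hk <;> linarith
  -- Exchanging `p` and `q` flips both signs, which leaves their sum modulo 2 unchanged.
  have hst : ∀ j, boolBit (s j) + boolBit (t j) = boolBit (x j) + boolBit (x (j + 1)) := by
    intro j
    have h1 := hval j (B j) (s j) (hs0 j) (hs1 j)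
    have h2 := hval (j + 1) (B j) (t j) (ht0 j) (ht1 j)
    rcases hpq (B j) (hB j) with h | h
    · rw [h1.1 h, h2.1 h]
    · rw [h1.2 h, h2.2 h]
      cases x j <;> cases x (j + 1) <;> decide
  have hsum : ∑ j, boolBit (x (j + 1)) = ∑ j, boolBit (x j) :=
    Equiv.sum_comp (Equiv.addRight (1 : Fin k)) (fun j => boolBit (x j))
  rw [Finset.sum_congr rfl (fun j _ => hst j), Finset.sum_add_distrib, hsum,
    CharTwo.add_self_eq_zero] at hodd
  exact zero_ne_one hodd

/-! ### Walks and shortest odd cycles in the double cover -/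

/-- `u` and `v` are joined by an `R`-walk of length `n`. -/
def WalkJoined {V : Type*} (R : V → V → Prop) : ℕ → V → V → Prop
  | 0, u, v => u = v
  | n + 1, u, v => ∃ w, R u w ∧ WalkJoined R n w v

namespace WalkJoined

variable {V : Type*} {R : V → V → Prop}

theorem trans {n n' : ℕ} {u v w : V} (h : WalkJoined R n u v) (h' : WalkJoined R n' v w) :
    WalkJoined R (n + n') u w := by
  induction n generalizing u with
  | zero => cases h; simpa using h'
  | succ n ih =>
    obtain ⟨z, hz, h⟩ := h
    rw [Nat.add_right_comm]
    exact ⟨z, hz, ih h⟩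

theorem single {u v : V} (h : R u v) : WalkJoined R 1 u v := ⟨v, h, rfl⟩

theorem symm (hR : ∀ u v, R u v → R v u) {n : ℕ} {u v : V} (h : WalkJoined R n u v) :
    WalkJoined R n v u := by
  induction n generalizing u with
  | zero => exact Eq.symm h
  | succ n ih =>
    obtain ⟨z, hz, h⟩ := h
    exact (ih h).trans (single (hR _ _ hz))

theorem map {σ : V → V} (hσ : ∀ u v, R u v → R (σ u) (σ v)) {n : ℕ} {u v : V}
    (h : WalkJoined R n u v) : WalkJoined R n (σ u) (σ v) := by
  induction n generalizing u with
  | zero => exact congrArg σ h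
  | succ n ih =>
    obtain ⟨z, hz, h⟩ := h
    exact ⟨σ z, hσ _ _ hz, ih h⟩

theorem exists_seq {n : ℕ} {u v : V} (h : WalkJoined R n u v) :
    ∃ f : ℕ → V, f 0 = u ∧ f n = v ∧ ∀ j < n, R (f j) (f (j + 1)) := by
  induction n generalizing u with
  | zero => exact ⟨fun _ => u, rfl, h, by simp⟩
  | succ n ih =>
    obtain ⟨z, hz, h⟩ := h
    obtain ⟨f, h0, hn, hf⟩ := ih h
    refine ⟨fun j => Nat.casesOn j u f, rfl, hn, fun j hj => ?_⟩
    cases j with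
    | zero => simpa [h0] using hz
    | succ j => exact hf j (by omega)

theorem of_seq {k : ℕ} {f : ℕ → V} (hf : ∀ j < k, R (f j) (f (j + 1))) {p q : ℕ} (hpq : p ≤ q)
    (hq : q ≤ k) : WalkJoined R (q - p) (f p) (f q) := by
  obtain ⟨n, rfl⟩ := Nat.exists_eq_add_of_le hpq
  rw [Nat.add_sub_cancel_left]
  induction n with
  | zero => exact rfl
  | succ n ih => exact (ih (by omega) (by omega)).trans (single (hf (p + n) (by omega)))

end WalkJoined

section Cycle

variable {ι κ : Type*} (P : ι → κ → Bool → Prop)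

/-- In the double cover of the coordinates: the member `i` links the two signed coordinates. -/
def Linked (i : ι) (u v : κ × Bool) : Prop :=
  ∃ y y', P i u.1 y ∧ P i v.1 y' ∧ (u.2 ^^ y) = (v.2 ^^ y')

/-- The antipodal map of the double cover. -/
def antipode (u : κ × Bool) : κ × Bool := (u.1, !u.2)

variable {P}

theorem Linked.symm {i : ι} {u v : κ × Bool} (h : Linked P i u v) : Linked P i v u := by
  obtain ⟨y, y', h, h', e⟩ := h
  exact ⟨y', y, h', h, e.symm⟩

theorem Linked.antipode {i : ι} {u v : κ × Bool} (h : Linked P i u v) :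
    Linked P i (antipode u) (antipode v) := by
  obtain ⟨y, y', h, h', e⟩ := h
  exact ⟨y, y', h, h', by simp [_root_.antipode, e]⟩

theorem eq_of_not_both (hP : ∀ i c, ¬ (P i c false ∧ P i c true)) {i : ι} {c : κ} {y y' : Bool}
    (h : P i c y) (h' : P i c y') : y = y' := by
  have := hP i c
  cases y <;> cases y' <;> tauto

theorem Linked.trans (hP : ∀ i c, ¬ (P i c false ∧ P i c true)) {i : ι} {u v w : κ × Bool}
    (h : Linked P i u v) (h' : Linked P i v w) : Linked P i u w := by
  obtain ⟨y, y', hu, hv, e⟩ := h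
  obtain ⟨z, z', hv', hw, e'⟩ := h'
  obtain rfl := eq_of_not_both hP hv hv'
  exact ⟨y, z', hu, hw, e.trans e'⟩

theorem not_linked_antipode (hP : ∀ i c, ¬ (P i c false ∧ P i c true)) {i : ι} {u : κ × Bool} :
    ¬ Linked P i u (antipode u) := by
  rintro ⟨y, y', h, h', e⟩
  obtain rfl := eq_of_not_both hP h h'
  revert e
  rcases u with ⟨c, x⟩
  cases x <;> cases y <;> simp [antipode]

theorem linked_or_linked_antipode {i : ι} {u v : κ × Bool} {y y' : Bool} (h : P i u.1 y)
    (h' : P i v.1 y') : Linked P i u v ∨ Linked P i v (antipode u) := by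
  rcases u with ⟨c, x⟩
  rcases v with ⟨c', x'⟩
  by_cases e : (x ^^ y) = (x' ^^ y')
  · exact Or.inl ⟨y, y', h, h', e⟩
  · refine Or.inr ⟨y', y, h', h, ?_⟩
    revert e
    cases x <;> cases y <;> cases x' <;> cases y' <;> simp [antipode]

/-- If no signed coordinate is joined to its antipode, then there is a consistent assignment. -/
theorem exists_assignment
    (h : ∀ n u, ¬ WalkJoined (fun u v => ∃ i, Linked P i u v) n u (antipode u)) :
    ∃ x : κ → Bool, ∀ i, (∀ c y, P i c y → y = x c) ∨ (∀ c y, P i c y → y = !x c) := by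
  classical
  set R : κ × Bool → κ × Bool → Prop := fun u v => ∃ i, Linked P i u v with hR
  have hRs : ∀ u v, R u v → R v u := fun u v ⟨i, hi⟩ => ⟨i, hi.symm⟩
  let S : Setoid (κ × Bool) :=
    { r := fun u v => ∃ n, WalkJoined R n u v
      iseqv := ⟨fun u => ⟨0, rfl⟩, fun ⟨n, hn⟩ => ⟨n, hn.symm hRs⟩,
        fun ⟨n, hn⟩ ⟨n', hn'⟩ => ⟨n + n', hn.trans hn'⟩⟩ }
  let : LinearOrder (Quotient S) := IsWellOrder.linearOrder WellOrderingRel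
  let g : κ × Bool → Quotient S := Quotient.mk S
  have hg : ∀ i u v, Linked P i u v → g u = g v := fun i u v hl =>
    Quotient.sound ⟨1, WalkJoined.single ⟨i, hl⟩⟩
  have hne : ∀ c, g (c, false) ≠ g (c, true) := by
    intro c hc
    obtain ⟨n, hn⟩ := Quotient.exact hc
    exact h n (c, false) hn
  -- Any linear order on the components picks one of the two lifts of each coordinate. Linked
  -- coordinates have the same pair of components, so the choices are consistent.
  let x : κ → Bool := fun c => decide (g (c, false) < g (c, true))
  have hx : ∀ i c c' e, Linked P i (c, false) (c', e) → x c' = (x c ^^ e) := by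
    intro i c c' e hl
    have h1 := hg _ _ _ hl
    have h2 := hg _ _ _ hl.antipode
    simp only [antipode, Bool.not_false] at h2
    cases e
    · simp only [Bool.not_false] at h2
      simp only [x, h1, h2, Bool.bne_false]
    · simp only [Bool.not_true] at h2
      simp only [x, h1, h2, Bool.bne_true]
      rcases lt_or_gt_of_ne (hne c') with hlt | hlt
      · simp [hlt, hlt.le]
      · simp [hlt, hlt.le]
  refine ⟨x, fun i => ?_⟩
  by_cases hi : ∃ c y, P i c y
  · obtain ⟨c, y, hy⟩ := hi
    have hall : ∀ c' y', P i c' y' → x c' = (x c ^^ (y ^^ y')) := fun c' y' hy' =>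
      hx i c c' _ ⟨y, y', hy, hy', by cases y <;> cases y' <;> rfl⟩
    by_cases hyx : y = x c
    · left
      intro c' y' hy'
      rw [hall c' y' hy', hyx]
      cases x c <;> cases y' <;> rfl
    · right
      intro c' y' hy'
      rw [hall c' y' hy']
      revert hyx
      cases x c <;> cases y' <;> cases y <;> simp
  · push Not at hi
    exact Or.inl fun c y hy => absurd hy (hi c y)

/-- If there is no consistent assignment, then there is an odd cycle each of whose chords is
absent: every member meets at most two of its coordinates. -/
theorem exists_odd_cycle (hP : ∀ i c, ¬ (P i c false ∧ P i c true))
    (h : ¬ ∃ x : κ → Bool, ∀ i, (∀ c y, P i c y → y = x c) ∨ (∀ c y, P i c y → y = !x c)) :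
    ∃ (k : ℕ) (_ : NeZero k) (c : Fin k → κ) (B : Fin k → ι) (s t : Fin k → Bool), 2 ≤ k ∧
      Function.Injective c ∧ (∀ j, P (B j) (c j) (s j)) ∧ (∀ j, P (B j) (c (j + 1)) (t j)) ∧
      ∑ j, (boolBit (s j) + boolBit (t j)) = 1 ∧
      ∀ i (S : Finset (Fin k)), (∀ j ∈ S, ∃ y, P i (c j) y) → S.card ≤ 2 := by
  classical
  set R : κ × Bool → κ × Bool → Prop := fun u v => ∃ i, Linked P i u v with hR
  have hex : ∃ n u, WalkJoined R n u (antipode u) := by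
    by_contra hcon
    push Not at hcon
    exact h (exists_assignment hcon)
  set k := Nat.find hex with hk
  have hmin : ∀ n u, WalkJoined R n u (antipode u) → k ≤ n := fun n u hn => Nat.find_min' hex ⟨u, hn⟩
  obtain ⟨u, hu⟩ := Nat.find_spec hex
  rw [← hk] at hu
  obtain ⟨f, hf0, hfk, hf⟩ := hu.exists_seq
  have hσ : ∀ u v, R u v → R (antipode u) (antipode v) := fun u v ⟨i, hi⟩ => ⟨i, hi.antipode⟩
  -- A shortcut from `f p` to `f q`, continued to `f k = antipode (f 0)` and on to `antipode (f p)`,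
  -- again joins a point to its antipode.
  have h1 : ∀ {n p q}, p ≤ q → q ≤ k → WalkJoined R n (f p) (f q) → q ≤ p + n := by
    intro n p q hpq hq hn
    have h2 : WalkJoined R p (antipode (f 0)) (antipode (f p)) :=
      (WalkJoined.of_seq hf (Nat.zero_le p) (hpq.trans hq)).map hσ
    rw [hf0, ← hfk] at h2
    have := hmin _ _ ((hn.trans (WalkJoined.of_seq hf hq le_rfl)).trans h2)
    omega
  have h2 : ∀ {n p q}, p ≤ q → q ≤ k → WalkJoined R n (f q) (antipode (f p)) → k + p ≤ q + n := by
    intro n p q hpq hq hn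
    have := hmin _ _ ((WalkJoined.of_seq hf hpq hq).trans hn)
    omega
  have hk2 : 2 ≤ k := by
    by_contra hlt
    have : k = 0 ∨ k = 1 := by omega
    rcases this with h0 | h0
    · rw [h0, hf0] at hfk
      have := congrArg Prod.snd hfk
      simp [antipode] at this
    · obtain ⟨i, hi⟩ := hf 0 (by omega)
      rw [zero_add, ← h0, hfk, hf0] at hi
      exact not_linked_antipode hP hi
  have : NeZero k := ⟨by omega⟩
  have hpair : ∀ {i p q y y'}, p < q → q < k → P i (f p).1 y → P i (f q).1 y' →
      (q = p + 1 ∧ Linked P i (f p) (f q)) ∨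
      (p = 0 ∧ q + 1 = k ∧ Linked P i (f q) (antipode (f p))) := by
    intro i p q y y' hpq hq hy hy'
    rcases linked_or_linked_antipode hy hy' with hl | hl
    · have := h1 hpq.le hq.le (WalkJoined.single ⟨i, hl⟩)
      exact Or.inl ⟨by omega, hl⟩
    · have := h2 hpq.le hq.le (WalkJoined.single ⟨i, hl⟩)
      exact Or.inr ⟨by omega, by omega, hl⟩
  -- Three pairwise adjacent coordinates force `k = 3`; the links of the single member `i` then
  -- compose to one from `f p` to its antipode.
  have htriple : ∀ {i p q r y y' y''}, p < q → q < r → r < k → P i (f p).1 y → P i (f q).1 y' →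
      P i (f r).1 y'' → False := by
    intro i p q r y y' y'' hpq hqr hr hy hy' hy''
    rcases hpair hpq (by omega) hy hy' with ⟨_, l1⟩ | ⟨_, _, _⟩
    · rcases hpair hqr (by omega) hy' hy'' with ⟨_, l2⟩ | ⟨_, _, _⟩
      · rcases hpair (hpq.trans hqr) (by omega) hy hy'' with ⟨_, _⟩ | ⟨_, _, l3⟩
        · omega
        · exact not_linked_antipode hP ((l1.trans hP l2).trans hP l3)
      · omega
    · omega
  have hne : ∀ {p q}, p < q → q < k → (f p).1 ≠ (f q).1 := by
    intro p q hpq hq e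
    by_cases e' : (f p).2 = (f q).2
    · have := h1 (n := 0) hpq.le hq.le (Prod.ext e e')
      omega
    · have := h2 (n := 0) hpq.le hq.le (Prod.ext e.symm (by
        simp only [antipode]
        revert e'
        cases (f p).2 <;> cases (f q).2 <;> simp))
      omega
  -- At the last index the walk arrives at the antipode of its start, which has the same coordinate.
  have hnext : ∀ j : Fin k, (f (j + 1 : Fin k).val).1 = (f (j.val + 1)).1 := by
    intro j
    by_cases hj : j.val + 1 < k
    · congr 2
      rw [Fin.val_add, Fin.val_one', Nat.mod_eq_of_lt (by omega : 1 < k), Nat.mod_eq_of_lt hj]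
    · have hj' : j.val + 1 = k := by omega
      have h0 : (j + 1 : Fin k).val = 0 := by
        rw [Fin.val_add, Fin.val_one', Nat.mod_eq_of_lt (by omega : 1 < k), hj', Nat.mod_self]
      rw [h0, hj', hfk, hf0]
      rfl
  have hstep : ∀ j : Fin k, ∃ i y y', P i (f j.val).1 y ∧ P i (f (j.val + 1)).1 y' ∧
      ((f j.val).2 ^^ y) = ((f (j.val + 1)).2 ^^ y') := fun j => hf j.val j.isLt
  choose B s t hs ht hst using hstep
  refine ⟨k, inferInstance, fun j => (f j.val).1, B, s, t, hk2, ?_, hs, ?_, ?_, ?_⟩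
  · intro p q e
    rcases lt_trichotomy p.val q.val with hlt | heq | hlt
    · exact absurd e (hne hlt q.isLt)
    · exact Fin.ext heq
    · exact absurd e.symm (hne hlt p.isLt)
  · intro j
    simp only [hnext]
    exact ht j
  · have hbit : ∀ j : Fin k, boolBit (s j) + boolBit (t j) =
        boolBit (f j.val).2 + boolBit (f (j.val + 1)).2 := by
      intro j
      have := hst j
      revert this
      cases s j <;> cases t j <;> cases (f j.val).2 <;> cases (f (j.val + 1)).2 <;> decide
    have htel : ∀ n, ∑ j ∈ Finset.range n, (boolBit (f j).2 + boolBit (f (j + 1)).2) =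
        boolBit (f 0).2 + boolBit (f n).2 := by
      intro n
      induction n with
      | zero => simp [CharTwo.add_self_eq_zero]
      | succ n ih =>
        rw [Finset.sum_range_succ, ih]
        generalize (f 0).2 = x, (f n).2 = y, (f (n + 1)).2 = z
        cases x <;> cases y <;> cases z <;> decide
    rw [Finset.sum_congr rfl (fun j _ => hbit j),
      Fin.sum_univ_eq_sum_range (fun j => boolBit (f j).2 + boolBit (f (j + 1)).2) k, htel, hfk,
      hf0]
    cases hv : u.2 <;> simp [antipode, boolBit, hv]
  · intro i S hS
    by_contra hcard
    obtain ⟨p, hp, q, hq, r, hr, hpq, hpr, hqr⟩ := Finset.two_lt_card.1 (not_le.1 hcard)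
    obtain ⟨yp, hyp⟩ := hS p hp
    obtain ⟨yq, hyq⟩ := hS q hq
    obtain ⟨yr, hyr⟩ := hS r hr
    have hpq' : p.val ≠ q.val := fun e => hpq (Fin.ext e)
    have hpr' : p.val ≠ r.val := fun e => hpr (Fin.ext e)
    have hqr' : q.val ≠ r.val := fun e => hqr (Fin.ext e)
    rcases lt_or_gt_of_ne hpq' with l1 | l1 <;> rcases lt_or_gt_of_ne hpr' with l2 | l2 <;>
      rcases lt_or_gt_of_ne hqr' with l3 | l3
    · exact htriple l1 l3 r.isLt hyp hyq hyr
    · exact htriple l2 l3 q.isLt hyp hyr hyq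
    · omega
    · exact htriple l2 l1 q.isLt hyr hyp hyq
    · exact htriple l1 l2 r.isLt hyq hyp hyr
    · omega
    · exact htriple l3 l2 p.isLt hyq hyr hyp
    · exact htriple l3 l1 p.isLt hyr hyq hyp

end Cycle

/-! ### Obstructions of bounded size in finite families -/

/-- The box `i` misses the upper (for `false`) or the lower (for `true`) of the two values
`lo c < hi c` in the coordinate `c`. -/
def Forced {ι κ : Type*} (a b : ι → κ → ℝ) (lo hi : κ → ℝ) (i : ι) (c : κ) : Bool → Prop
  | false => b i c < hi c
  | true => lo c < a i c

/-- A box contains, in each coordinate, whichever of `lo` and `hi` it is not forced to miss. One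
point takes the values chosen by `x`, the other the opposite ones. -/
theorem twoPierced_of_assignment {ι κ : Type*} {a b : ι → κ → ℝ} {lo hi : κ → ℝ}
    (hlo : ∀ i c, lo c ≤ b i c) (hhi : ∀ i c, a i c ≤ hi c) (x : κ → Bool)
    (hx : ∀ i, (∀ c y, Forced a b lo hi i c y → y = x c) ∨
      (∀ c y, Forced a b lo hi i c y → y = !x c)) : TwoPierced a b Set.univ := by
  have key : ∀ (z : κ → Bool) i, (∀ c y, Forced a b lo hi i c y → y = z c) →
      (fun c => if z c then hi c else lo c) ∈ Set.Icc (a i) (b i) := by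
    intro z i hz
    refine ⟨fun c => ?_, fun c => ?_⟩ <;> by_cases hc : z c = true <;> simp only [hc]
    · exact hhi i c
    · by_contra hcon
      exact hc (hz c true (not_le.1 hcon)).symm
    · by_contra hcon
      have := hz c false (not_le.1 hcon)
      rw [hc] at this
      exact Bool.noConfusion this
    · exact hlo i c
  exact ⟨_, _, fun i _ => (hx i).imp (key x i) (key (fun c => !x c) i)⟩

/-- The number of boxes to add in a coordinate `c` of an odd cycle, where the two boxes of the cycle
which meet there are `u` and `w`. -/
theorem exists_separating_boxes {ι κ : Type*} [DecidableEq ι] {a b : ι → κ → ℝ}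
    (hab : ∀ i c, a i c ≤ b i c) {lo hi : κ → ℝ}
    (hlo : ∀ i c, lo c ≤ b i c) (hhi : ∀ i c, a i c ≤ hi c) {A C : κ → ι}
    (hA : ∀ c, b (A c) c = lo c) (hC : ∀ c, a (C c) c = hi c)
    (hcase : ∀ i c, ¬ (Forced a b lo hi i c false ∧ Forced a b lo hi i c true))
    {c : κ} {u w : ι} {x y : Bool} (hu : Forced a b lo hi u c x) (hw : Forced a b lo hi w c y) :
    ∃ (E : Finset ι) (l h : ℝ), l < h ∧ (∃ i, (i = u ∨ i = w ∨ i ∈ E) ∧ b i c ≤ l) ∧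
      (∃ i, (i = u ∨ i = w ∨ i ∈ E) ∧ h ≤ a i c) ∧
      (x = false → b u c < h) ∧ (x = true → l < a u c) ∧
      (y = false → b w c < h) ∧ (y = true → l < a w c) ∧
      E.card ≤ (if x = y then 1 else if a u c = b u c ∨ a w c = b w c then 0 else 2) := by
  have hu' := hcase u c
  have hw' := hcase w c
  have h1 := hab u c
  have h2 := hab w c
  have h3 := hlo u c
  have h4 := hlo w c
  have h5 := hhi u c
  have h6 := hhi w c
  cases x <;> cases y <;> simp only [Forced, not_and, not_lt] at hu hw hu' hw'
  -- With equal signs, `u` itself serves as the separating box on one side.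
  · exact ⟨{C c}, b u c, hi c, hu, ⟨u, by simp, le_rfl⟩, ⟨C c, by simp, (hC c).ge⟩, by simpa,
      by simp, by simpa, by simp, by simp⟩
  · by_cases hd : a u c = b u c ∨ a w c = b w c
    -- By `hcase` the interval of `u` starts at or below `lo` and that of `w` ends at or above `hi`,
    -- so if one is a point the two are disjoint and separate by themselves.
    · have hlt : b u c < a w c := by
        have := hu' hu
        rcases hd with hd | hd
        · linarith
        · by_contra hcon
          exact absurd (hw' (by linarith)) (by linarith)
      exact ⟨∅, b u c, a w c, hlt, ⟨u, by simp, le_rfl⟩, ⟨w, by simp, le_rfl⟩, by simpa, by simp,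
        by simp, by simpa, by simp⟩
    · exact ⟨{A c, C c}, lo c, hi c, by linarith, ⟨A c, by simp, (hA c).le⟩,
        ⟨C c, by simp, (hC c).ge⟩, by simpa, by simp, by simp, by simpa,
        by simpa [hd] using Finset.card_le_two⟩
  · by_cases hd : a u c = b u c ∨ a w c = b w c
    · have hlt : b w c < a u c := by
        have := hw' hw
        rcases hd with hd | hd
        · by_contra hcon
          exact absurd (hu' (by linarith)) (by linarith)
        · linarith
      exact ⟨∅, b w c, a u c, hlt, ⟨w, by simp, le_rfl⟩, ⟨u, by simp, le_rfl⟩, by simp, by simpa,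
        by simpa, by simp, by simp⟩
    · exact ⟨{A c, C c}, lo c, hi c, by linarith, ⟨A c, by simp, (hA c).le⟩,
        ⟨C c, by simp, (hC c).ge⟩, by simp, by simpa, by simpa, by simp,
        by simpa [hd] using Finset.card_le_two⟩
  · exact ⟨{A c}, lo c, a u c, hu, ⟨A c, by simp, (hA c).le⟩, ⟨u, by simp, le_rfl⟩, by simp,
      by simpa, by simp, by simpa, by simp⟩

theorem three_le_flatBoxNumber {m : ℕ} (hm : 1 ≤ m) : 3 ≤ flatBoxNumber m := by
  unfold flatBoxNumber
  split_ifs <;> omega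

/-- The number of boxes used: `k` is the length of the cycle, `u` and `t` are the numbers of its
coordinates where the two boxes agree and differ, and `w` counts those of the latter where one of
the boxes is degenerate. -/
theorem cycle_count_le_flatBoxNumber {m k u t w : ℕ} (hm : 1 ≤ m) (hk : 2 ≤ k) (hkm : k ≤ m + 2)
    (hut : u + t = k) (ht : Odd t) (hwt : w ≤ t) (h1 : k = m + 1 → k ≤ 2 * (u + w))
    (h2 : k = m + 2 → w = t) : k + (u + 2 * (t - w)) ≤ flatBoxNumber m := by
  -- The count equals `2k + t - 2w`. For `k ≤ m` it is at most `3k`, or `3k - 1` if `k` is even, as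
  -- `t` is odd; for `k = m + 2` it is `2k - t ≤ 2m + 3`, which gives the exceptional values 5 and
  -- 7.
  obtain ⟨r, rfl⟩ := ht
  unfold flatBoxNumber
  split_ifs with e1 e2 e3
  · omega
  · omega
  · obtain ⟨r', rfl⟩ := e3
    omega
  · obtain ⟨r', rfl⟩ := Nat.not_odd_iff_even.1 e3
    omega

theorem exists_finset_card_le_not_twoPierced {ι κ : Type*} [Finite ι] [Fintype κ]
    {a b : ι → κ → ℝ} (hab : ∀ i c, a i c ≤ b i c) {m : ℕ} (hm : 1 ≤ m)
    (hcard : ∀ i, (Finset.univ.filter fun c => a i c < b i c).card ≤ m)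
    (hn : ¬ TwoPierced a b Set.univ) :
    ∃ G : Finset ι, G.card ≤ flatBoxNumber m ∧ ¬ TwoPierced a b (G : Set ι) := by
  classical
  have hne : Nonempty ι := by
    by_contra hcon
    rw [not_nonempty_iff] at hcon
    exact hn ⟨0, 0, fun i => isEmptyElim i⟩
  choose A hA using fun c => Finite.exists_min (fun i => b i c)
  choose C hC using fun c => Finite.exists_max (fun i => a i c)
  set lo : κ → ℝ := fun c => b (A c) c with hlo
  set hi : κ → ℝ := fun c => a (C c) c with hhi
  by_cases hcase : ∀ i c, ¬ (Forced a b lo hi i c false ∧ Forced a b lo hi i c true)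
  swap
  · push Not at hcase
    obtain ⟨i, c, h1, h2⟩ := hcase
    simp only [Forced, hlo, hhi] at h1 h2
    -- The projections of `A c`, `i` and `C c` to coordinate `c` are pairwise disjoint.
    refine ⟨{i, A c, C c}, Finset.card_le_three.trans (three_le_flatBoxNumber hm), ?_⟩
    rintro ⟨p, q, hpq⟩
    have := hab i c
    rcases hpq i (by simp) with h | h <;> rcases hpq (A c) (by simp) with h' | h' <;>
      rcases hpq (C c) (by simp) with h'' | h'' <;> have t1 := h.1 c <;> have t2 := h.2 c <;>
      have t3 := h'.2 c <;> have t4 := h''.1 c <;> linarith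
  have hlo' : ∀ i c, lo c ≤ b i c := fun i c => hA c i
  have hhi' : ∀ i c, a i c ≤ hi c := fun i c => hC c i
  have hx : ¬ ∃ x : κ → Bool, ∀ i, (∀ c y, Forced a b lo hi i c y → y = x c) ∨
      (∀ c y, Forced a b lo hi i c y → y = !x c) := fun ⟨x, hx⟩ =>
    hn (twoPierced_of_assignment hlo' hhi' x hx)
  obtain ⟨k, _, c, B, s, t, hk, hcinj, hs, ht, hsum, hsupp⟩ := exists_odd_cycle hcase hx
  -- the degenerate coordinates of the boxes of the cycle
  have h01 : ∀ j : Fin k, j ≠ j + 1 := by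
    intro j e
    have h1 : (1 : Fin k) = 0 := by simpa using e
    have := congrArg Fin.val h1
    rw [Fin.val_one', Nat.mod_eq_of_lt (by omega : 1 < k)] at this
    simp at this
  have hactive : ∀ j, lo (c j) < hi (c j) := by
    intro j
    have h1 := hs j
    cases e : s j <;> rw [e] at h1
    · exact (hlo' _ _).trans_lt h1
    · exact h1.trans_le (hhi' _ _)
  let D : Fin k → Finset (Fin k) := fun j => {i | a (B j) (c i) = b (B j) (c i)}
  have hDcard : ∀ j, k ≤ (D j).card + m := by
    intro j
    have h1 : ({i | a (B j) (c i) < b (B j) (c i)} : Finset (Fin k)).card ≤ m := by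
      refine le_trans ?_ (hcard (B j))
      exact Finset.card_le_card_of_injOn c (fun i hi => by simpa using hi) hcinj.injOn
    have h2 := Finset.card_filter_add_card_filter_not (s := (Finset.univ : Finset (Fin k)))
      (fun i => a (B j) (c i) = b (B j) (c i))
    have h3 : ({i | ¬ a (B j) (c i) = b (B j) (c i)} : Finset (Fin k)) =
        ({i | a (B j) (c i) < b (B j) (c i)} : Finset (Fin k)) := by
      ext i
      simpa using (hab (B j) (c i)).lt_iff_ne.symm
    rw [h3, Finset.card_univ, Fintype.card_fin] at h2
    have : (D j).card = ({i | a (B j) (c i) = b (B j) (c i)} : Finset (Fin k)).card := rfl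
    omega
  -- A point interval misses `lo` or `hi` where these differ, so a degenerate cycle coordinate is
  -- always forced; `hsupp` leaves room only for `j` and `j + 1`.
  have hD : ∀ j, D j ⊆ {j, j + 1} := by
    intro j
    have hcard2 : ({j, j + 1} : Finset (Fin k)).card = 2 := Finset.card_pair (h01 j)
    have hle := hsupp (B j) (D j ∪ {j, j + 1}) (by
      intro i hmem
      simp only [Finset.mem_union, Finset.mem_insert, Finset.mem_singleton] at hmem
      rcases hmem with hmem | rfl | rfl
      · have hdeg : a (B j) (c i) = b (B j) (c i) := by simpa [D] using hmem
        have := hactive i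
        by_cases hlt : b (B j) (c i) < hi (c i)
        · exact ⟨false, hlt⟩
        · refine ⟨true, ?_⟩
          simp only [Forced]
          linarith
      · exact ⟨_, hs i⟩
      · exact ⟨_, ht j⟩)
    have heq := Finset.eq_of_subset_of_card_le
      (Finset.subset_union_right : ({j, j + 1} : Finset (Fin k)) ⊆ D j ∪ {j, j + 1})
      (by rw [hcard2]; exact hle)
    rw [heq]
    exact Finset.subset_union_left
  have hDle : ∀ j, (D j).card ≤ 2 := fun j => (Finset.card_le_card (hD j)).trans Finset.card_le_two
  -- the boxes to add
  have hprev : ∀ j, Forced a b lo hi (B (j - 1)) (c j) (t (j - 1)) := by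
    intro j
    have := ht (j - 1)
    rwa [sub_add_cancel] at this
  choose E l h hlh hl hh hs0 hs1 ht0 ht1 hE using fun j =>
    exists_separating_boxes hab hlo' hhi' (fun _ => rfl) (fun _ => rfl) hcase (hs j) (hprev j)
  let G : Finset ι := Finset.univ.image B ∪ Finset.univ.biUnion E
  have hBG : ∀ j, B j ∈ (G : Set ι) := fun j => by simp [G]
  have hmemG : ∀ j i, (i = B j ∨ i = B (j - 1) ∨ i ∈ E j) → i ∈ (G : Set ι) := by
    rintro j i (rfl | rfl | hi)
    · exact hBG _
    · exact hBG _
    · simp only [G, Finset.coe_union, Set.mem_union, Finset.mem_coe, Finset.mem_biUnion]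
      exact Or.inr ⟨j, Finset.mem_univ _, hi⟩
  refine ⟨G, ?_, not_twoPierced_of_odd_cycle c B s t l h hlh hBG
    (fun j => (hl j).imp fun i hi => ⟨hmemG j i hi.1, hi.2⟩)
    (fun j => (hh j).imp fun i hi => ⟨hmemG j i hi.1, hi.2⟩) hs0 hs1
    (fun j => by simpa using ht0 (j + 1)) (fun j => by simpa using ht1 (j + 1)) hsum⟩
  -- counting
  let U : Finset (Fin k) := {j | s j = t (j - 1)}
  let T : Finset (Fin k) := {j | ¬ s j = t (j - 1)}
  let Q : Fin k → Prop := fun j => a (B j) (c j) = b (B j) (c j) ∨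
    a (B (j - 1)) (c j) = b (B (j - 1)) (c j)
  let W : Finset (Fin k) := T.filter Q
  have hUT : U.card + T.card = k := by
    have := Finset.card_filter_add_card_filter_not (s := (Finset.univ : Finset (Fin k)))
      (fun j => s j = t (j - 1))
    rwa [Finset.card_univ, Fintype.card_fin] at this
  have hTodd : Odd T.card := by
    rw [← ZMod.natCast_eq_one_iff_odd, ← hsum, Finset.sum_add_distrib,
      ← Equiv.sum_comp (Equiv.subRight (1 : Fin k)) (fun j => boolBit (t j)),
      ← Finset.sum_add_distrib]
    simp only [Equiv.subRight_apply, boolBit_add, T, Finset.natCast_card_filter, ne_eq]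
  have hEsum : ∑ j, (E j).card ≤ U.card + 2 * (T.card - W.card) := by
    have hW := Finset.card_filter_add_card_filter_not (s := T) Q
    have h1 : T.card - W.card = (T.filter fun j => ¬ Q j).card := by
      have : W.card = (T.filter Q).card := rfl
      omega
    have h2 : ∀ j, (E j).card ≤ (if j ∈ U then 1 else 0) +
        2 * (if j ∈ T.filter (fun j => ¬ Q j) then 1 else 0) := by
      intro j
      refine (hE j).trans (le_of_eq ?_)
      by_cases e : s j = t (j - 1) <;> by_cases e' : Q j <;> simp [U, T, e, e'] <;>
        (simp only [Q] at e'; tauto)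
    refine (Finset.sum_le_sum fun j _ => h2 j).trans (le_of_eq ?_)
    rw [Finset.sum_add_distrib, ← Finset.mul_sum, h1]
    simp only [Finset.sum_boole, Finset.filter_mem_eq_inter, Finset.univ_inter, Nat.cast_id]
  have hGcard : G.card ≤ k + ∑ j, (E j).card := by
    refine (Finset.card_union_le _ _).trans (Nat.add_le_add ?_ Finset.card_biUnion_le)
    exact Finset.card_image_le.trans (by simp)
  refine (hGcard.trans (Nat.add_le_add_left hEsum k)).trans
    (cycle_count_le_flatBoxNumber hm hk ?_ hUT hTodd (Finset.card_filter_le _ _) ?_ ?_)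
  · have := hDcard 0
    have := hDle 0
    omega
  · intro hkm
    have hmem : ∀ j, Q j → j ∈ U ∪ W := by
      intro j hj
      by_cases e : s j = t (j - 1) <;> simp [U, W, T, e, hj]
    -- Each cycle box is now degenerate at one of its two coordinates, which lies in `U ∪ W`; so
    -- this set and its shift cover the cycle.
    have hcov : (Finset.univ : Finset (Fin k)) ⊆
        (U ∪ W) ∪ (U ∪ W).map (Equiv.subRight (1 : Fin k)).toEmbedding := by
      intro j _
      have hpos : 0 < (D j).card := by
        have := hDcard j
        omega
      obtain ⟨i, hi⟩ := Finset.card_pos.1 hpos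
      have hi' : a (B j) (c i) = b (B j) (c i) := by simpa [D] using hi
      have hij := hD j hi
      simp only [Finset.mem_insert, Finset.mem_singleton] at hij
      rw [Finset.mem_union]
      rcases hij with rfl | rfl
      · exact Or.inl (hmem _ (Or.inl hi'))
      · refine Or.inr (Finset.mem_map.2 ⟨j + 1, hmem _ (Or.inr ?_), by simp⟩)
        simpa using hi'
    have h1 := Finset.card_le_card hcov
    have h2 := Finset.card_union_le (U ∪ W) ((U ∪ W).map (Equiv.subRight (1 : Fin k)).toEmbedding)
    have h3 := Finset.card_union_le U W
    rw [Finset.card_map] at h2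
    rw [Finset.card_univ, Fintype.card_fin] at h1
    omega
  · intro hkm
    refine congrArg Finset.card (Finset.filter_true_of_mem fun j _ => Or.inl ?_)
    have hDj : D j = {j, j + 1} := by
      refine Finset.eq_of_subset_of_card_le (hD j) ?_
      rw [Finset.card_pair (h01 j)]
      have := hDcard j
      omega
    have : j ∈ D j := by simp [hDj]
    simpa [D] using this

/-! ### Infinite families -/

/-- Compactness: a family of boxes is pierced by two points if all its finite subfamilies are. -/
theorem twoPierced_of_finset {ι κ : Type*} {a b : ι → κ → ℝ}
    (h : ∀ S : Finset ι, TwoPierced a b (S : Set ι)) : TwoPierced a b Set.univ := by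
  classical
  by_cases hdis : ∃ i j c, b j c < a i c
  · obtain ⟨i₀, j₀, c, hc⟩ := hdis
    -- Two disjoint boxes must contain one point each, which confines the pair to a compact product.
    have hK : IsCompact (Set.Icc (a i₀) (b i₀) ×ˢ Set.Icc (a j₀) (b j₀)) :=
      isCompact_Icc.prod isCompact_Icc
    let Z : ι → Set ((κ → ℝ) × (κ → ℝ)) := fun i =>
      {z | z.1 ∈ Set.Icc (a i) (b i)} ∪ {z | z.2 ∈ Set.Icc (a i) (b i)}
    have hZ : ∀ i, IsClosed (Z i) := fun i =>
      (isClosed_Icc.preimage continuous_fst).union (isClosed_Icc.preimage continuous_snd)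
    obtain ⟨z, -, hz⟩ := hK.inter_iInter_nonempty Z hZ (by
      intro S
      obtain ⟨p, q, hpq⟩ := h (insert i₀ (insert j₀ S))
      have hS : ∀ i ∈ S, p ∈ Set.Icc (a i) (b i) ∨ q ∈ Set.Icc (a i) (b i) := fun i hi =>
        hpq i (by simp [hi])
      rcases hpq i₀ (by simp) with h1 | h1 <;> rcases hpq j₀ (by simp) with h2 | h2
      · exact absurd ((h1.1 c).trans (h2.2 c)) (not_le.2 hc)
      · exact ⟨(p, q), ⟨h1, h2⟩, Set.mem_iInter₂.2 hS⟩
      · exact ⟨(q, p), ⟨h1, h2⟩, Set.mem_iInter₂.2 fun i hi => (hS i hi).symm⟩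
      · exact absurd ((h1.1 c).trans (h2.2 c)) (not_le.2 hc))
    exact ⟨z.1, z.2, fun i _ => Set.mem_iInter.1 hz i⟩
  · push Not at hdis
    -- Pairwise intersecting boxes have a common point, by Helly's theorem on the line in each
    -- coordinate.
    refine ⟨fun c => ⨆ i, a i c, 0, fun i _ => Or.inl ⟨fun c => ?_, fun c => ?_⟩⟩
    · exact le_ciSup (f := fun i => a i c) ⟨b i c, by rintro _ ⟨j, rfl⟩; exact hdis j i c⟩ i
    · have : Nonempty ι := ⟨i⟩
      exact ciSup_le fun j => hdis j i c

theorem exists_finset_card_le_not_twoPierced_of_infinite {ι κ : Type*} [Fintype κ]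
    {a b : ι → κ → ℝ} (hab : ∀ i c, a i c ≤ b i c) {m : ℕ} (hm : 1 ≤ m)
    (hcard : ∀ i, (Finset.univ.filter fun c => a i c < b i c).card ≤ m)
    (hn : ¬ TwoPierced a b Set.univ) :
    ∃ G : Finset ι, G.card ≤ flatBoxNumber m ∧ ¬ TwoPierced a b (G : Set ι) := by
  have : ∃ S : Finset ι, ¬ TwoPierced a b (S : Set ι) := by
    by_contra hcon
    push Not at hcon
    exact hn (twoPierced_of_finset hcon)
  obtain ⟨S, hS⟩ := this
  obtain ⟨G, hG, hG'⟩ := exists_finset_card_le_not_twoPierced (ι := S)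
    (a := fun i => a i) (b := fun i => b i) (fun i => hab i) hm (fun i => hcard i) (by
      rintro ⟨p, q, hpq⟩
      exact hS ⟨p, q, fun i hi => hpq ⟨i, hi⟩ trivial⟩)
  refine ⟨G.map (Function.Embedding.subtype _), by simpa using hG, ?_⟩
  rintro ⟨p, q, hpq⟩
  exact hG' ⟨p, q, fun i hi => hpq i (by simpa using hi)⟩

/-! ### Critical families and passage to sets of boxes -/

/-- A family of `n` `m`-boxes in `ℝ^e`, not pierced by two points, all of whose proper subfamilies
are. -/
structure IsCriticalFamily {ι : Type*} [Fintype ι] {e : ℕ} (m n : ℕ) (a b : ι → Fin e → ℝ) :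
    Prop where
  le : ∀ i c, a i c ≤ b i c
  dim : ∀ i, (Finset.univ.filter fun c => a i c < b i c).card = m
  card : Fintype.card ι = n
  not_twoPierced : ¬ TwoPierced a b Set.univ
  twoPierced : ∀ i, TwoPierced a b {i}ᶜ

/-- Adding coordinates in which all boxes are the point `0`. -/
theorem IsCriticalFamily.extend {ι : Type*} [Fintype ι] {e d m n : ℕ} (hed : e ≤ d)
    {a b : ι → Fin e → ℝ} (h : IsCriticalFamily m n a b) :
    IsCriticalFamily m n (fun i (c : Fin d) => if hc : c.val < e then a i ⟨c, hc⟩ else 0)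
      (fun i (c : Fin d) => if hc : c.val < e then b i ⟨c, hc⟩ else 0) where
  le i c := by
    by_cases hc : c.val < e
    · simpa [hc] using h.le i _
    · simp [hc]
  dim i := by
    rw [← h.dim i, ← Finset.card_map (Fin.castLEEmb hed)]
    congr 1
    ext c
    simp only [Finset.mem_filter, Finset.mem_univ, true_and, Finset.mem_map]
    by_cases hc : c.val < e
    · simp only [hc, dif_pos]
      constructor
      · exact fun hlt => ⟨⟨c, hc⟩, hlt, rfl⟩
      · rintro ⟨c', hlt, rfl⟩
        exact hlt
    · simp only [hc, dif_neg, not_false_iff, lt_self_iff_false, false_iff, not_exists, not_and]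
      rintro c' - rfl
      exact hc c'.isLt
  card := h.card
  not_twoPierced := by
    rintro ⟨p, q, hpq⟩
    refine h.not_twoPierced ⟨fun c => p (Fin.castLE hed c), fun c => q (Fin.castLE hed c),
      fun i hi => (hpq i hi).imp (fun hp => ?_) (fun hp => ?_)⟩ <;>
    · refine ⟨fun c => ?_, fun c => ?_⟩
      · simpa using hp.1 (Fin.castLE hed c)
      · simpa using hp.2 (Fin.castLE hed c)
  twoPierced i := by
    obtain ⟨p, q, hpq⟩ := h.twoPierced i
    refine ⟨fun c => if hc : c.val < e then p ⟨c, hc⟩ else 0,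
      fun c => if hc : c.val < e then q ⟨c, hc⟩ else 0,
      fun i hi => (hpq i hi).imp (fun hp => ?_) (fun hp => ?_)⟩ <;>
    · refine ⟨fun c => ?_, fun c => ?_⟩ <;> by_cases hc : c.val < e
      · simpa [hc] using hp.1 _
      · simp [hc]
      · simpa [hc] using hp.2 _
      · simp [hc]

/-- Coinciding points are padded to a set of exactly two, which needs a coordinate. -/
theorem isPierceable_two_iff {d : ℕ} (hd : 1 ≤ d) {F : Set (Set (Fin d → ℝ))} :
    IsPierceable 2 F ↔ ∃ p q : Fin d → ℝ, ∀ B ∈ F, p ∈ B ∨ q ∈ B := by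
  classical
  constructor
  · rintro ⟨P, hP, h⟩
    obtain ⟨p, q, -, rfl⟩ := Finset.card_eq_two.1 hP
    exact ⟨p, q, fun B hB => by simpa using h B hB⟩
  · rintro ⟨p, q, h⟩
    by_cases hpq : p = q
    · subst hpq
      have hne : p ≠ p + 1 := fun e => by
        have := congrFun e ⟨0, hd⟩
        simp at this
      exact ⟨{p, p + 1}, Finset.card_pair hne, fun B hB => ⟨p, by simp, by simpa using h B hB⟩⟩
    · exact ⟨{p, q}, Finset.card_pair hpq, fun B hB => by simpa using h B hB⟩

theorem IsPierceable.mono {d n : ℕ} {F G : Set (Set (Fin d → ℝ))} (h : IsPierceable n F)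
    (hGF : G ⊆ F) : IsPierceable n G := by
  obtain ⟨P, hP, h⟩ := h
  exact ⟨P, hP, fun B hB => h B (hGF hB)⟩

theorem IsCriticalFamily.le_of_piercingProperty {ι : Type*} [Fintype ι] {d m n k : ℕ}
    (hd : 1 ≤ d) {a b : ι → Fin d → ℝ} (h : IsCriticalFamily m n a b)
    (hk : PiercingProperty d m 2 k) : n ≤ k := by
  by_contra! hlt
  let f : ι → Set (Fin d → ℝ) := fun i => Set.Icc (a i) (b i)
  -- Points piercing all boxes but `i` would also pierce `i` if it had a duplicate.
  have hinj : Function.Injective f := by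
    intro i j hij
    by_contra hne
    obtain ⟨p, q, hpq⟩ := h.twoPierced i
    refine h.not_twoPierced ⟨p, q, fun l _ => ?_⟩
    by_cases hl : l = i
    · have hj := hpq j (by simpa using fun e => hne e.symm)
      have hij' : Set.Icc (a i) (b i) = Set.Icc (a j) (b j) := hij
      rwa [hl, hij']
    · exact hpq l (by simpa using hl)
  have hcard : (Set.range f).encard = n := by
    rw [← Set.image_univ, hinj.encard_image, Set.encard_univ, ENat.card_eq_coe_fintype_card, h.card]
  have key := (hk (Set.range f) (Set.finite_range f)
    (by rintro _ ⟨i, rfl⟩; exact ⟨a i, b i, h.le i, h.dim i, rfl⟩)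
    (by rw [hcard]; exact_mod_cast hlt.le)).2 (by
      intro G hG hGk
      have : ∃ i, f i ∉ G := by
        by_contra! hcon
        have := Set.encard_le_encard (Set.range_subset_iff.2 hcon)
        rw [hcard, hGk] at this
        exact absurd (by exact_mod_cast this) (not_le.2 hlt)
      obtain ⟨i, hi⟩ := this
      obtain ⟨p, q, hpq⟩ := h.twoPierced i
      refine (isPierceable_two_iff hd).2 ⟨p, q, fun B hB => ?_⟩
      obtain ⟨j, rfl⟩ := hG hB
      exact hpq j (by rintro rfl; exact hi hB))
  obtain ⟨p, q, hpq⟩ := (isPierceable_two_iff hd).1 key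
  exact h.not_twoPierced ⟨p, q, fun i _ => hpq _ ⟨i, rfl⟩⟩

theorem isPierceable_two_iff_of_encard {d m : ℕ} (hm : 1 ≤ m) (hmd : m ≤ d)
    (F : Set (Set (Fin d → ℝ))) (hF : ∀ B ∈ F, IsBox m B)
    (hcard : (flatBoxNumber m : ℕ∞) ≤ F.encard) :
    IsPierceable 2 F ↔ ∀ G ⊆ F, G.encard = flatBoxNumber m → IsPierceable 2 G := by
  refine ⟨fun h G hG _ => h.mono hG, fun h => ?_⟩
  choose a b hab hdim hIcc using fun B : F => hF B.1 B.2
  by_contra hn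
  have hd : 1 ≤ d := hm.trans hmd
  obtain ⟨G, hG, hGn⟩ := exists_finset_card_le_not_twoPierced_of_infinite hab hm
    (fun i => (hdim i).le) (by
      rintro ⟨p, q, hpq⟩
      refine hn ((isPierceable_two_iff hd).2 ⟨p, q, fun B hB => ?_⟩)
      have := hpq ⟨B, hB⟩ trivial
      rwa [← hIcc] at this)
  have hG' : ((Subtype.val '' (G : Set F) : Set (Set (Fin d → ℝ)))).encard ≤ flatBoxNumber m := by
    rw [Subtype.val_injective.encard_image, Set.encard_coe_eq_coe_finsetCard]
    exact_mod_cast hG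
  -- The obstruction may be too small, so it is enlarged to exactly `flatBoxNumber m` members.
  obtain ⟨H, hGH, hHF, hH⟩ := Set.exists_superset_subset_encard_eq
    (Subtype.coe_image_subset F (G : Set F)) hG' hcard
  obtain ⟨p, q, hpq⟩ := (isPierceable_two_iff hd).1 (h H hHF hH)
  refine hGn ⟨p, q, fun i hi => ?_⟩
  have := hpq i.1 (hGH ⟨i, hi, rfl⟩)
  rwa [hIcc i] at this

/-! ### Explicit critical families -/

/-- A critical family with integer coordinates, from an odd cycle and the piercing points of its
maximal proper subfamilies. -/
theorem IsCriticalFamily.of_int {ι : Type*} [Fintype ι] {e m n k : ℕ} [NeZero k]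
    {a b : ι → Fin e → ℤ} (hle : ∀ i c, a i c ≤ b i c)
    (hdim : ∀ i, (Finset.univ.filter fun c => a i c < b i c).card = m)
    (hcard : Fintype.card ι = n)
    (c : Fin k → Fin e) (B A C : Fin k → ι) (s t : Fin k → Bool) (lo hi : Fin k → ℤ)
    (hlh : ∀ j, lo j < hi j) (hlo : ∀ j, b (A j) (c j) ≤ lo j) (hhi : ∀ j, hi j ≤ a (C j) (c j))
    (hs0 : ∀ j, s j = false → b (B j) (c j) < hi j)
    (hs1 : ∀ j, s j = true → lo j < a (B j) (c j))
    (ht0 : ∀ j, t j = false → b (B j) (c (j + 1)) < hi (j + 1))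
    (ht1 : ∀ j, t j = true → lo (j + 1) < a (B j) (c (j + 1)))
    (hodd : ∑ j, (boolBit (s j) + boolBit (t j)) = 1)
    (hp : ∀ i, ∃ p q : Fin e → ℤ, ∀ j, j ≠ i →
      (∀ c, a j c ≤ p c ∧ p c ≤ b j c) ∨ (∀ c, a j c ≤ q c ∧ q c ≤ b j c)) :
    IsCriticalFamily m n (fun i c => (a i c : ℝ)) (fun i c => (b i c : ℝ)) where
  le i c := by exact_mod_cast hle i c
  dim i := by simpa using hdim i
  card := hcard
  not_twoPierced := not_twoPierced_of_odd_cycle c B s t (fun j => (lo j : ℝ)) (fun j => (hi j : ℝ))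
    (fun j => by exact_mod_cast hlh j) (fun _ => trivial)
    (fun j => ⟨A j, trivial, by exact_mod_cast hlo j⟩)
    (fun j => ⟨C j, trivial, by exact_mod_cast hhi j⟩)
    (fun j h => by exact_mod_cast hs0 j h) (fun j h => by exact_mod_cast hs1 j h)
    (fun j h => by exact_mod_cast ht0 j h) (fun j h => by exact_mod_cast ht1 j h) hodd
  twoPierced i := by
    obtain ⟨p, q, h⟩ := hp i
    refine ⟨fun c => p c, fun c => q c, fun j hj => (h j hj).imp (fun h => ?_) (fun h => ?_)⟩ <;>
      exact ⟨fun c => Int.cast_le.2 (h c).1, fun c => Int.cast_le.2 (h c).2⟩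

/-- Five segments in the plane. -/
theorem exists_isCriticalFamily_one : ∃ a b : Fin 5 → Fin 2 → ℝ, IsCriticalFamily 1 5 a b := by
  -- Boxes 0 and 1 form the cycle. Their signs agree in coordinate 0 (one extra box) and differ in
  -- coordinate 1 (two extra).
  refine ⟨_, _, IsCriticalFamily.of_int (k := 2)
    (a := ![![0, -1], ![0, 1], ![3, -1], ![-1, 0], ![-1, 3]])
    (b := ![![0, 2], ![0, 4], ![3, 4], ![4, 0], ![4, 3]])
    (by decide) (by decide) (by decide) ![0, 1] ![0, 1] ![0, 3] ![2, 4] ![false, true]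
    ![false, false] ![0, 0] ![3, 3] (by decide) (by decide) (by decide) (by decide) (by decide)
    (by decide) (by decide) (by decide) fun i =>
    ⟨![![0, 3], ![0, 0], ![0, 0], ![0, 2], ![0, 1]] i,
      ![![3, 0], ![3, 3], ![0, 3], ![3, 3], ![3, 0]] i, ?_⟩⟩
  revert i
  decide

/-- Seven rectangles in space. -/
theorem exists_isCriticalFamily_two : ∃ a b : Fin 7 → Fin 3 → ℝ, IsCriticalFamily 2 7 a b := by
  -- Boxes 0, 1, 2 form the cycle. Signs differ only in coordinate 0, so the extra boxes number 2 +
  -- 1 + 1.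
  refine ⟨_, _, IsCriticalFamily.of_int (k := 3)
    (a := ![![-1, 0, -1], ![-1, -1, 0], ![1, -1, 0], ![-1, 3, -1], ![-1, -1, 3], ![0, -1, -1],
      ![3, -1, -1]])
    (b := ![![2, 0, 4], ![4, 2, 0], ![4, 4, 0], ![4, 3, 4], ![4, 4, 3], ![0, 4, 4], ![3, 4, 4]])
    (by decide) (by decide) (by decide) ![0, 1, 2] ![0, 1, 2] ![5, 0, 1] ![6, 3, 4]
    ![false, false, false] ![false, false, true] ![0, 0, 0] ![3, 3, 3] (by decide) (by decide)
    (by decide) (by decide) (by decide) (by decide) (by decide) (by decide) fun i =>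
    ⟨![![3, 0, 0], ![3, 3, 0], ![0, 0, 0], ![3, 0, 0], ![0, 0, 0], ![2, 0, 0], ![1, 0, 0]] i,
      ![![0, 3, 3], ![0, 0, 3], ![3, 3, 3], ![0, 0, 3], ![3, 3, 0], ![3, 3, 3], ![0, 3, 3]] i, ?_⟩⟩
  revert i
  decide

/-- A sequence of increments around a cycle can be integrated after removing one edge. -/
theorem exists_integral_of_ne {m : ℕ} [NeZero m] (g : Fin m → Bool) (j₀ : Fin m) :
    ∃ x : Fin m → Bool, ∀ j, j ≠ j₀ → x (j + 1) = (x j ^^ g j) := by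
  let y : ℕ → Bool := fun n => Nat.rec false (fun n z => z ^^ g (j₀ + 1 + Fin.ofNat m n)) n
  refine ⟨fun j => y (j - (j₀ + 1)).val, fun j hj => ?_⟩
  have h1 : j + 1 - (j₀ + 1) = (j - (j₀ + 1)) + 1 := add_sub_right_comm _ _ _
  have hlt : (j - (j₀ + 1)).val + 1 < m := by
    by_contra hcon
    have hval : (j - (j₀ + 1)).val + 1 = m := by omega
    apply hj
    have : j - (j₀ + 1) + 1 = 0 := by
      apply Fin.ext
      rw [Fin.val_add, Fin.val_one', Nat.add_mod_mod, hval, Nat.mod_self]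
      rfl
    rw [← h1] at this
    simpa [sub_eq_zero] using this
  have h2 : (j - (j₀ + 1) + 1).val = (j - (j₀ + 1)).val + 1 := by
    rw [Fin.val_add, Fin.val_one', Nat.add_mod_mod, Nat.mod_eq_of_lt hlt]
  simp only [h1, h2]
  change (y _ ^^ g _) = _
  rw [Fin.ofNat_eq_cast, Fin.cast_val_eq_self, add_sub_cancel]

/-- Lower corners of a critical family of full-dimensional boxes. The boxes are indexed by pairs
`(j, r)`: the coordinate `j` is bounded above for `r = 0` and below for `r = 2`, while the boxes with
`r = 1` form a cycle. -/
def cycleLower (m : ℕ) [NeZero m] (x : Fin m × Fin 3) (c : Fin m) : ℤ :=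
  if x.2 = 1 then (if c = x.1 + 1 ∧ ¬ (Even m ∧ c = 0) then 1 else -1)
  else if x.2 = 2 ∧ c = x.1 then 3 else -1

/-- Upper corners of a critical family of full-dimensional boxes. -/
def cycleUpper (m : ℕ) [NeZero m] (x : Fin m × Fin 3) (c : Fin m) : ℤ :=
  if x.2 = 1 then (if c = x.1 ∨ (c = x.1 + 1 ∧ Even m ∧ c = 0) then 2 else 4)
  else if x.2 = 0 ∧ c = x.1 then 0 else 4

theorem exists_cycle_points {m : ℕ} [NeZero m] (hm : ∀ j : Fin m, j + 1 ≠ j) (i : Fin m × Fin 3)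
    (hi : ¬ (Even m ∧ i = (0, 0))) :
    ∃ p q : Fin m → ℤ, ∀ j, ¬ (Even m ∧ j = (0, 0)) → j ≠ i →
      (∀ c, cycleLower m j c ≤ p c ∧ p c ≤ cycleUpper m j c) ∨
      (∀ c, cycleLower m j c ≤ q c ∧ q c ≤ cycleUpper m j c) := by
  obtain ⟨i, r⟩ := i
  -- Deleting any box breaks the parity condition at one edge: at `i - 1` if the lower separator of
  -- `i` goes, at `i` otherwise.
  obtain ⟨x, hx⟩ := exists_integral_of_ne (fun j : Fin m => !decide (Even m ∧ j + 1 = 0))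
    (if r = 0 then i - 1 else i)
  -- Without a separator at `i`, both values there move to the same side: 2 and 3 satisfy the lower
  -- bound 1, while 0 and 1 satisfy the upper bound 2.
  let lo : Fin m → ℤ := fun c => if r = 0 ∧ c = i then 2 else 0
  let hi' : Fin m → ℤ := fun c => if r = 2 ∧ c = i then 1 else 3
  let w : Bool → Fin m → ℤ := fun y c => if (x c ^^ y) then hi' c else lo c
  have hlo : ∀ c, 0 ≤ lo c ∧ lo c ≤ 2 := fun c => by simp only [lo]; split_ifs <;> norm_num
  have hhi : ∀ c, 1 ≤ hi' c ∧ hi' c ≤ 3 := fun c => by simp only [hi']; split_ifs <;> norm_num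
  have hw : ∀ y c, 0 ≤ w y c ∧ w y c ≤ 3 := fun y c => by
    have := hlo c
    have := hhi c
    simp only [w]
    split_ifs <;> omega
  have hw0 : ∀ c, w (x c) c = lo c := fun c => by simp [w]
  have hw1 : ∀ c, w (!x c) c = hi' c := fun c => by cases h : x c <;> simp [w, h]
  refine ⟨w false, w true, ?_⟩
  rintro ⟨j, r'⟩ hj hji
  suffices h : ∃ y, ∀ c, cycleLower m (j, r') c ≤ w y c ∧ w y c ≤ cycleUpper m (j, r') c by
    obtain ⟨y, hy⟩ := h
    cases y
    · exact Or.inl hy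
    · exact Or.inr hy
  have h012 : ∀ z : Fin 3, z = 0 ∨ z = 1 ∨ z = 2 := by decide
  rcases h012 r' with rfl | rfl | rfl
  · refine ⟨x j, fun c => ?_⟩
    have h1 := hw (x j) c
    by_cases hc : c = j
    · subst hc
      have : lo c = 0 := by
        simp only [lo]
        rw [if_neg]
        rintro ⟨rfl, rfl⟩
        exact hji rfl
      simp [cycleLower, cycleUpper, hw0, this]
    · simp [cycleLower, cycleUpper, hc]
      omega
  · have hB : ∀ y, w y j ≤ 2 → (¬ (Even m ∧ j + 1 = 0) → 1 ≤ w y (j + 1)) →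
        ((Even m ∧ j + 1 = 0) → w y (j + 1) ≤ 2) →
        ∀ c, cycleLower m (j, 1) c ≤ w y c ∧ w y c ≤ cycleUpper m (j, 1) c := by
      intro y h1 h2 h3 c
      have h4 := hw y c
      by_cases hc : c = j
      · subst hc
        have := (hm c).symm
        simp [cycleLower, cycleUpper, this]
        omega
      · by_cases hc' : c = j + 1
        · subst hc'
          by_cases ht : Even m ∧ j + 1 = 0
          · have := h3 ht
            simp [cycleLower, cycleUpper, ht.1, ht.2]
            rw [ht.2] at this h4
            omega
          · have := h2 ht
            simp [cycleLower, cycleUpper, ht, hm]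
            omega
        · simp [cycleLower, cycleUpper, hc, hc']
          omega
    by_cases hj0 : j = if r = 0 then i - 1 else i
    · by_cases hr : r = 0
      · subst hr
        simp only [if_true] at hj0
        subst hj0
        refine ⟨x (i - 1), hB _ ?_ ?_ ?_⟩
        · rw [hw0]
          exact (hlo _).2
        · intro _
          simp only [sub_add_cancel, w, lo, hi']
          split_ifs <;> simp_all
        · rintro ⟨h1, h2⟩
          rw [sub_add_cancel] at h2
          exact absurd ⟨h1, by rw [h2]⟩ hi
      · rw [if_neg hr] at hj0
        subst hj0
        have hr2 : r = 2 := by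
          have h1 : r ≠ 1 := by
            rintro rfl
            exact hji rfl
          exact ((h012 r).resolve_left hr).resolve_left h1
        subst hr2
        have hwj : ∀ y, w y j ≤ 2 := by
          intro y
          simp only [w, lo, hi']
          split_ifs <;> simp_all
        by_cases ht : Even m ∧ j + 1 = 0
        · refine ⟨x (j + 1), hB _ (hwj _) (fun h => absurd ht h) fun _ => ?_⟩
          rw [hw0]
          exact (hlo _).2
        · refine ⟨!x (j + 1), hB _ (hwj _) (fun _ => ?_) fun h => absurd h ht⟩
          rw [hw1]
          exact (hhi _).1
    · have hxj := hx j hj0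
      refine ⟨x j, hB _ ?_ ?_ ?_⟩
      · rw [hw0]
        exact (hlo _).2
      · intro ht
        have : x j = !x (j + 1) := by simp [hxj, ht]
        rw [this, hw1]
        exact (hhi _).1
      · intro ht
        have : x j = x (j + 1) := by rw [hxj]; simp [ht]
        rw [this, hw0]
        exact (hlo _).2
  · refine ⟨!x j, fun c => ?_⟩
    have h1 := hw (!x j) c
    by_cases hc : c = j
    · subst hc
      have : hi' c = 3 := by
        simp only [hi']
        rw [if_neg]
        rintro ⟨rfl, rfl⟩
        exact hji rfl
      simp [cycleLower, cycleUpper, hw1, this]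
    · simp [cycleLower, cycleUpper, hc]
      omega

/-- The cycle boxes have unequal signs in every coordinate, except in coordinate 0 for even `m`,
which keeps the number of sign changes odd. There a cycle box doubles as lower separator (hence `lo
= 2`), so `(0, 0)` is dropped. -/
theorem exists_isCriticalFamily_of_three_le {m : ℕ} [NeZero m] (hm : 3 ≤ m) :
    ∃ a b : {x : Fin m × Fin 3 // ¬ (Even m ∧ x = (0, 0))} → Fin m → ℝ,
      IsCriticalFamily m (flatBoxNumber m) a b := by
  have hne : ∀ j : Fin m, j + 1 ≠ j := by
    intro j e
    have h1 : (1 : Fin m) = 0 := by simpa using e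
    have := congrArg Fin.val h1
    rw [Fin.val_one', Nat.mod_eq_of_lt (by omega : 1 < m)] at this
    simp at this
  have hlt : ∀ x c, cycleLower m x c < cycleUpper m x c := by
    intro x c
    have := hne x.1
    simp only [cycleLower, cycleUpper]
    split_ifs <;> simp_all
  refine ⟨_, _, IsCriticalFamily.of_int (k := m)
    (ι := {x : Fin m × Fin 3 // ¬ (Even m ∧ x = (0, 0))}) (a := fun x => cycleLower m x.1)
    (b := fun x => cycleUpper m x.1) (fun x c => (hlt x.1 c).le) ?_ ?_ id
    (fun j => ⟨(j, 1), by simp⟩)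
    (fun j => if h : Even m ∧ j = 0 then ⟨(j, 1), by simp⟩ else ⟨(j, 0), by simpa using h⟩)
    (fun j => ⟨(j, 2), by simp⟩) (fun _ => false) (fun j => !decide (Even m ∧ j + 1 = 0))
    (fun j => if Even m ∧ j = 0 then 2 else 0) (fun _ => 3) ?_ ?_ ?_ ?_ ?_ ?_ ?_ ?_ ?_⟩
  · intro x
    simp [hlt]
  · unfold flatBoxNumber
    rw [if_neg (by omega), if_neg (by omega), Fintype.card_subtype_compl, Fintype.card_prod,
      Fintype.card_fin, Fintype.card_fin]
    by_cases he : Even m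
    · rw [if_neg (Nat.not_odd_iff_even.2 he)]
      simp [he, mul_comm]
    · rw [if_pos (Nat.not_even_iff_odd.1 he)]
      simp [he, mul_comm]
  · intro j
    split_ifs <;> norm_num
  · intro j
    by_cases h : Even m ∧ j = 0 <;> simp [h, cycleUpper]
  · intro j
    simp [cycleLower]
  · intro j _
    simp [cycleUpper]
  · simp
  · intro j h
    have h' : Even m ∧ j + 1 = 0 := by simpa using h
    simp [cycleUpper, h'.1, h'.2]
  · intro j h
    have h' : ¬ (Even m ∧ j + 1 = 0) := by rwa [Bool.not_eq_true', decide_eq_false_iff_not] at h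
    simp [cycleLower, h']
  · have h1 : ∀ j : Fin m, boolBit false + boolBit (!decide (Even m ∧ j + 1 = 0)) =
        1 - if j = -1 then (if Even m then 1 else 0) else 0 := by
      intro j
      have : j + 1 = 0 ↔ j = -1 := eq_neg_iff_add_eq_zero.symm
      by_cases h : Even m <;> by_cases h' : j = -1 <;> simp [h, h', boolBit, this]
    rw [Finset.sum_congr rfl fun j _ => h1 j, Finset.sum_sub_distrib, Finset.sum_ite_eq']
    by_cases he : Even m
    · simp [he, (ZMod.natCast_eq_zero_iff_even).2 he]
    · simp [he, (ZMod.natCast_eq_one_iff_odd).2 (Nat.not_even_iff_odd.1 he)]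
  · rintro ⟨i, hi⟩
    obtain ⟨p, q, h⟩ := exists_cycle_points hne i hi
    exact ⟨p, q, fun j hj => h j.1 j.2 fun e => hj (Subtype.ext e)⟩

theorem mainTheorem1 (d m : ℕ) (hm : 1 ≤ m) (hmd : m ≤ d) :
    (∀ F : Set (Set (Fin d → ℝ)), (∀ B ∈ F, IsBox m B) →
      (flatBoxNumber m : ℕ∞) ≤ F.encard →
        (IsPierceable 2 F ↔ ∀ G ⊆ F, G.encard = flatBoxNumber m → IsPierceable 2 G)) ∧
    (m < d ∨ 3 ≤ m → IsLeast {k : ℕ | PiercingProperty d m 2 k} (flatBoxNumber m)) := by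
  refine ⟨isPierceable_two_iff_of_encard hm hmd, fun h =>
    ⟨fun F _ => isPierceable_two_iff_of_encard hm hmd F, fun k hk => ?_⟩⟩
  have hd : 1 ≤ d := hm.trans hmd
  by_cases h3 : 3 ≤ m
  · have : NeZero m := ⟨by omega⟩
    obtain ⟨a, b, hab⟩ := exists_isCriticalFamily_of_three_le h3
    exact (hab.extend hmd).le_of_piercingProperty hd hk
  · have h12 : m = 1 ∨ m = 2 := by omega
    rcases h12 with rfl | rfl
    · obtain ⟨a, b, hab⟩ := exists_isCriticalFamily_one
      exact (hab.extend (by omega : 2 ≤ d)).le_of_piercingProperty hd hk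
    · obtain ⟨a, b, hab⟩ := exists_isCriticalFamily_two
      exact (hab.extend (by omega : 3 ≤ d)).le_of_piercingProperty hd hk
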